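/- Let $X$ be a real Hilbert space with inner product $(\cdot,\cdot)$, let $X^*$ be its dual and $\langle\cdot,\cdot\rangle$ the duality bracket between $X^*$ and $X$. Assume: (B1) $Q_0,Q_1:X\to X^*$ are bounded symmetric linear operators with $\langle Q_0u,u\rangle>0$ and $\langle Q_1u,u\rangle>0$ for all $0\neq u\in X$, and $\langle (Q_0+Q_1)u,v\rangle=(u,v)$ for all $u,v\in X$. (B2) $\mathbb J:X\to X$ is a bounded linear operator with $\mathbb J^{-1}=-\mathbb J$ and $\langle Q_0\mathbb Ju,\mathbb Ju\rangle=\langle Q_0u,u\rangle$ for all $u\in X$. Let $J=\mathbb JQ_0^{-1}:X^*\supset D(J)\to X$ with $D(J)=Q_0(X)$. (B3) $L:X\to X^*$ is a bounded symmetric linear operator such that $L_1=L-Q_1$ satisfies, for some constant $c_0$ and all $u,v\in X$, $$|\langle L_1u,v\rangle|^2\le c_0\big(\langle Q_0u,u\rangle\langle Q_0v,v\rangle+\langle Q_0u,u\rangle\langle Q_1v,v\rangle+\langle Q_1u,u\rangle\langle Q_0v,v\rangle\big).$$ (B4) There are closed subspaces $X_\pm\subset X$ with $X=X_-\oplus\ker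 L\oplus X_+$ and $\dim X_-<\infty$, such that $\pm\langle Lu_\pm,u_\pm\rangle>0$ for all $0\neq u_\pm\in X_\pm$, and $\langle Lu_+,u_-\rangle=0$ for all $u_\pm\in X_\pm$. (B5) Every $f\in X^*$ with $\langle f,u\rangle=0$ for all $u\in X_+$ belongs to $Q_0(X)=D(J)$. Then there exist a real Hilbert space $Y$ and an injective bounded linear map $i:X\to Y$ with dense range (so $X$ is densely embedded into $Y$, and $i^*:f\mapsto f\circ i$ embeds $Y^*$ into $X^*$), and a bounded symmetric linear operator $L_Y:Y\to Y^*$ extending $L$, that is, $\langle L_Y\,iu,iv\rangle=\langle Lu,v\rangle$ for all $u,v\in X$, with the following properties. Let $J_Y:Y^*\supset D(J_Y)\to Y$ be the restriction of $J$ to $D(J)\cap Y^*$, that is, $D(J_Y)=\{f\in Y^*\mid i^*f\in D(J)\}$ and $J_Yf=iJi^*f$. Then: (H1) $J_Y$ is densely defined and anti-self-dual: $J_Y^*=-J_Y$ (including equality of domains), where $J_Y^*:Y^*\supset D(J_Y^*)\to Y^{**}=Y$ is the dual operator. (H2) There are closed subspaces $Y_\pm\subset Y$ with $Y=Y_-\oplus\ker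 L_Y\oplus Y_+$ and $\dim Y_-<\infty$, such that $\langle L_Yu,u\rangle<0$ for all $0\neq u\in Y_-$, and for some $\delta>0$, $\langle L_Yu,u\rangle\ge\delta\|u\|_Y^2$ for all $u\in Y_+$. (H3) These $Y_\pm$ satisfy: every $f\in Y^*$ with $\langle f,u\rangle=0$ for all $u\in Y_-\oplus Y_+$ belongs to $D(J_Y)$. -/

import Mathlib

universe u

namespace LinHam

/-- `X` is the direct sum of the three subspaces `A`, `B`, `C`. -/
def IsDirectSum {X : Type*} [AddCommGroup X] [Module ℝ X] (A B C : Submodule ℝ X) : Prop :=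
  Disjoint A B ∧ IsCompl (A ⊔ B) C

/-- The graph of the dual operator of `T : E ⊃ D(T) → F`: the pairs `(f, g)` in `F* × E*` with
`⟨g, x⟩ = ⟨f, T x⟩` for all `x ∈ D(T)`. -/
def dualGraph {E F : Type*} [NormedAddCommGroup E] [NormedSpace ℝ E]
    [NormedAddCommGroup F] [NormedSpace ℝ F] (T : E →ₗ.[ℝ] F) :
    Submodule ℝ (StrongDual ℝ F × StrongDual ℝ E) where
  carrier := {p | ∀ x : T.domain, p.2 (x : E) = p.1 (T x)}
  add_mem' := by
    intro p q hp hq x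
    simp only [Set.mem_ofPred_eq] at hp hq
    simp [hp x, hq x]
  zero_mem' := by
    intro x
    simp
  smul_mem' := by
    intro c p hp x
    simp only [Set.mem_ofPred_eq] at hp
    simp [hp x]

/-- The dual operator `T* : F* ⊃ D(T*) → E*` of an unbounded operator `T : E ⊃ D(T) → F`
(meaningful when `D(T)` is dense in `E`, so that `dualGraph T` is single-valued). -/
noncomputable def dualOp {E F : Type*} [NormedAddCommGroup E] [NormedSpace ℝ E]
    [NormedAddCommGroup F] [NormedSpace ℝ F] (T : E →ₗ.[ℝ] F) :
    StrongDual ℝ F →ₗ.[ℝ] StrongDual ℝ E :=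
  (dualGraph T).toLinearPMap

/-- `J : X* ⊃ D(J) → X` is densely defined and `J* = -J` (equality of unbounded operators,
domains included), where `X` is regarded as a subspace of `X**` through the canonical map. -/
def IsAntiSelfDual {X : Type*} [NormedAddCommGroup X] [NormedSpace ℝ X]
    (J : StrongDual ℝ X →ₗ.[ℝ] X) : Prop :=
  Dense (J.domain : Set (StrongDual ℝ X)) ∧
    dualOp J = (NormedSpace.inclusionInDoubleDual ℝ X).toLinearMap.compPMap (-J)

/-- The bilinear form `⟨L u, v⟩` is symmetric, that is `L* = L`. -/
def IsSymm {X : Type*} [NormedAddCommGroup X] [NormedSpace ℝ X]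
    (L : X →L[ℝ] StrongDual ℝ X) : Prop :=
  ∀ u v : X, L u v = L v u

/-- `X = X₋ ⊕ ker L ⊕ X₊` is a decomposition into closed subspaces with `dim X₋ < ∞`, with `L`
negative on `X₋` and uniformly positive on `X₊`. -/
structure IsUniformDecomposition {X : Type*} [NormedAddCommGroup X] [NormedSpace ℝ X]
    (L : X →L[ℝ] StrongDual ℝ X) (Xm Xp : Submodule ℝ X) : Prop where
  closed_neg : IsClosed (Xm : Set X)
  closed_pos : IsClosed (Xp : Set X)
  directSum : IsDirectSum Xm (LinearMap.ker L.toLinearMap) Xp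
  finite_neg : FiniteDimensional ℝ Xm
  neg : ∀ u ∈ Xm, u ≠ 0 → L u u < 0
  pos : ∃ δ : ℝ, 0 < δ ∧ ∀ u ∈ Xp, δ * ‖u‖ ^ 2 ≤ L u u

/-- The standing assumptions on a linear Hamiltonian system `∂ₜ u = J L u` on `X`: `J` is
anti-self-dual; `L` is symmetric (and bounded) and has a decomposition `X = X₋ ⊕ ker L ⊕ X₊` as
above; and every functional that vanishes on `X₋ ⊕ X₊` lies in `D(J)`. -/
def IsHamiltonianSystem {X : Type*} [NormedAddCommGroup X] [NormedSpace ℝ X]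
    (L : X →L[ℝ] StrongDual ℝ X) (J : StrongDual ℝ X →ₗ.[ℝ] X) : Prop :=
  IsAntiSelfDual J ∧ IsSymm L ∧
    ∃ Xm Xp : Submodule ℝ X, IsUniformDecomposition L Xm Xp ∧
      ∀ f : StrongDual ℝ X, (∀ u ∈ Xm ⊔ Xp, f u = 0) → f ∈ J.domain

/-- The operator `J = 𝕁 Q₀⁻¹ : X* ⊃ Q₀(X) → X` (for injective `Q₀`). -/
noncomputable def symplecticOp {X : Type*} [NormedAddCommGroup X] [NormedSpace ℝ X]
    (𝕁 : X →L[ℝ] X) (Q₀ : X →L[ℝ] StrongDual ℝ X) : StrongDual ℝ X →ₗ.[ℝ] X :=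
  𝕁.toLinearMap.compPMap (Q₀.toLinearMap.toPMap ⊤).inverse

/-- For an embedding `i : X → Y`, with `Y*` viewed inside `X*` through `i* f = f ∘ i`, the
restriction `J_Y : D(J) ∩ Y* → Y` of `J : X* ⊃ D(J) → X`. Its domain is
`{f ∈ Y* | i* f ∈ D(J)}` and `J_Y f = i (J (i* f))`. -/
def restrictOp {X Y : Type*} [NormedAddCommGroup X] [NormedSpace ℝ X]
    [NormedAddCommGroup Y] [NormedSpace ℝ Y] (i : X →L[ℝ] Y)
    (J : StrongDual ℝ X →ₗ.[ℝ] X) : StrongDual ℝ Y →ₗ.[ℝ] Y where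
  domain :=
    { carrier := {f | f.comp i ∈ J.domain}
      add_mem' := by
        intro f g hf hg
        simp only [Set.mem_ofPred_eq, ContinuousLinearMap.add_comp] at *
        exact J.domain.add_mem hf hg
      zero_mem' := by
        simp
      smul_mem' := by
        intro c f hf
        simp only [Set.mem_ofPred_eq, ContinuousLinearMap.smul_comp] at *
        exact J.domain.smul_mem c hf }
  toFun :=
    { toFun := fun f => i (J ⟨(f : StrongDual ℝ Y).comp i, f.2⟩)
      map_add' := by
        intro f g
        rw [← map_add, ← LinearPMap.map_add]
        rfl
      map_smul' := by
        intro c f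
        rw [RingHom.id_apply, ← map_smul, ← LinearPMap.map_smul]
        rfl }

end LinHam

namespace LinHam

/-! Let `P` be the projection onto `X₋ ⊕ ker L` along `X₊`. The form `b = L + (‖L‖ + 1)(P ·, P ·)`
is positive definite, and `Y` is the completion of `X` for `b`. Since `P` extends to `Y`, so does
`L`, as the inner product minus a multiple of `(P ·, P ·)`; on the kernel of the extended `P` it is
the inner product itself, hence uniformly positive (`exists_extension`). The main point is `J_Y* =
-J_Y`. By `isAntiSelfDual_of_surjective` it is enough that `λ R ± J_Y` are onto, `R` being the Riesz
map. Writing `i* f = Q₀ w` and testing against `i v` turns this into `λ Q₀ w ± b 𝕁 w = g` on `X`,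
which `exists_solution` solves by Lax-Milgram for large `λ`, because (B3) makes `b` coercive up to a
multiple of `Q₀`. -/

/-! ### Completion with respect to a form -/

/-- A symmetric positive definite bounded form on `X` is the restriction of the inner product of a
Hilbert space in which `X` is dense. -/
theorem exists_completion_of_form {X : Type u} [NormedAddCommGroup X] [NormedSpace ℝ X]
    (b : X →L[ℝ] StrongDual ℝ X) (hsymm : IsSymm b) (hpos : ∀ u, u ≠ 0 → 0 < b u u) :
    ∃ (Y : Type u) (_ : NormedAddCommGroup Y) (_ : InnerProductSpace ℝ Y) (_ : CompleteSpace Y)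
      (i : X →L[ℝ] Y), Function.Injective i ∧ DenseRange i ∧
        ∀ u v, inner ℝ (i u) (i v) = b u v := by
  -- The bare vector space `V` carries no norm, so the norm of `B` does not clash with the given
  -- norm of `X`.
  have key : ∀ (V : Type u) [AddCommGroup V] [Module ℝ V] (B : V →ₗ[ℝ] V →ₗ[ℝ] ℝ)
      (_ : ∀ u v, B u v = B v u) (_ : ∀ u, u ≠ 0 → 0 < B u u),
      ∃ (Y : Type u) (_ : NormedAddCommGroup Y) (_ : InnerProductSpace ℝ Y) (_ : CompleteSpace Y)
        (i : V →ₗ[ℝ] Y), DenseRange i ∧ ∀ u v, inner ℝ (i u) (i v) = B u v := by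
    intro V _ _ B hs hp
    let core : InnerProductSpace.Core ℝ V :=
      { inner := fun u v => B u v
        conj_inner_symm := fun u v => by simpa using hs v u
        re_inner_nonneg := fun u => by
          rcases eq_or_ne u 0 with rfl | h
          · simp
          · simpa using (hp u h).le
        add_left := fun u v w => by simp
        smul_left := fun u v r => by simp
        definite := fun u h => by
          by_contra hu
          exact (hp u hu).ne' h }
    let _ : NormedAddCommGroup V := core.toNormedAddCommGroup
    let _ : InnerProductSpace ℝ V := InnerProductSpace.ofCore core.toCore
    refine ⟨UniformSpace.Completion V, inferInstance, inferInstance, inferInstance,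
      (UniformSpace.Completion.toComplL (𝕜 := ℝ) (E := V)).toLinearMap, ?_, ?_⟩
    · exact UniformSpace.Completion.denseRange_coe
    · intro u v
      exact UniformSpace.Completion.inner_coe (𝕜 := ℝ) u v
  obtain ⟨Y, _, _, _, i, hd, hi⟩ := key X
    (LinearMap.mk₂ ℝ (fun u v => b u v) (by simp) (by simp) (by simp) (by simp)) hsymm hpos
  simp only [LinearMap.mk₂_apply] at hi
  refine ⟨Y, inferInstance, inferInstance, inferInstance,
    i.mkContinuous (√‖b‖) fun u => ?_, ?_, hd, hi⟩
  · refine abs_le_of_sq_le_sq' ?_ (by positivity) |>.2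
    rw [← real_inner_self_eq_norm_sq, hi, mul_pow, Real.sq_sqrt (norm_nonneg b)]
    calc b u u ≤ ‖b u u‖ := Real.le_norm_self _
      _ ≤ ‖b‖ * ‖u‖ * ‖u‖ := b.le_opNorm₂ u u
      _ = ‖b‖ * ‖u‖ ^ 2 := by ring
  · refine (injective_iff_map_eq_zero _).2 fun u hu => ?_
    by_contra h
    have h1 := hi u u
    rw [show i u = 0 from hu, inner_zero_left] at h1
    exact (hpos u h).ne h1

/-! ### A range criterion for anti-self-duality -/

/-- A subspace that is annihilated by no nonzero functional is dense. -/
theorem dense_of_forall_dual_eq_zero {E : Type*} [NormedAddCommGroup E] [NormedSpace ℝ E]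
    (p : Submodule ℝ E) (h : ∀ g : StrongDual ℝ E, (∀ x ∈ p, g x = 0) → g = 0) :
    Dense (p : Set E) := by
  intro x
  by_contra hx
  obtain ⟨g, s, hs, hsx⟩ := geometric_hahn_banach_closed_point p.convex.closure isClosed_closure hx
  have hg : g = 0 := h g fun y hy => by
    by_contra hne
    have h1 := hs (((s + 1) / g y) • y) (subset_closure (p.smul_mem _ hy))
    rw [map_smul, smul_eq_mul, div_mul_cancel₀ _ hne] at h1
    linarith
  have h0 := hs 0 (subset_closure p.zero_mem)
  simp only [hg, zero_apply] at h0 hsx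
  exact lt_asymm h0 hsx

/-- An antisymmetric operator `J : Y* ⊃ D(J) → Y` on a Hilbert space is anti-self-dual if
`λ R ± J` are surjective for some `λ > 0`, where `R : Y* → Y` is the Riesz isomorphism. -/
theorem isAntiSelfDual_of_surjective {Y : Type*} [NormedAddCommGroup Y] [InnerProductSpace ℝ Y]
    [CompleteSpace Y] (J : StrongDual ℝ Y →ₗ.[ℝ] Y)
    (hanti : ∀ f g : J.domain, (f : StrongDual ℝ Y) (J g) = -(g : StrongDual ℝ Y) (J f))
    {l : ℝ} (hl : 0 < l)
    (hadd : ∀ y, ∃ f : J.domain,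
      l • (InnerProductSpace.toDual ℝ Y).symm (f : StrongDual ℝ Y) + J f = y)
    (hsub : ∀ y, ∃ f : J.domain,
      l • (InnerProductSpace.toDual ℝ Y).symm (f : StrongDual ℝ Y) - J f = y) :
    IsAntiSelfDual J := by
  set R := (InnerProductSpace.toDual ℝ Y).symm with hR
  have hRapp : ∀ (f : StrongDual ℝ Y) y, f y = inner ℝ (R f) y := fun f y => by
    simp [hR, InnerProductSpace.toDual_symm_apply]
  have hRsymm : ∀ f g : StrongDual ℝ Y, f (R g) = g (R f) := fun f g => by
    rw [hRapp, hRapp g, real_inner_comm]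
  have hRpos : ∀ f : StrongDual ℝ Y, f (R f) = 0 → f = 0 := fun f hf => by
    rw [hRapp, inner_self_eq_zero] at hf
    simpa using hf
  have hrepr : ∀ g : StrongDual ℝ (StrongDual ℝ Y), ∃ y : Y, ∀ h : StrongDual ℝ Y, g h = h y := by
    intro g
    let g' : StrongDual ℝ Y :=
      LinearMap.mkContinuous
        { toFun := fun x => g (InnerProductSpace.toDual ℝ Y x)
          map_add' := by simp
          map_smul' := by simp } ‖g‖ (fun x => by
            simpa using g.le_opNorm (InnerProductSpace.toDual ℝ Y x))
    refine ⟨R g', fun h => ?_⟩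
    rw [hRsymm]
    simp [g', hR]
  have hdense : Dense (J.domain : Set (StrongDual ℝ Y)) := by
    refine dense_of_forall_dual_eq_zero _ fun g hg => ?_
    obtain ⟨y, hy⟩ := hrepr g
    obtain ⟨f, hf⟩ := hadd y
    have h1 : (f : StrongDual ℝ Y) y = 0 := by rw [← hy, hg _ f.2]
    -- Antisymmetry gives `f (J f) = 0`, so only `l * f (R f)` is left of `f y = 0`.
    have h2 := hanti f f
    rw [← hf, map_add, map_smul, smul_eq_mul] at h1
    have h3 : (f : StrongDual ℝ Y) (R f) = 0 := by
      have : l * (f : StrongDual ℝ Y) (R f) = 0 := by linarith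
      exact (mul_eq_zero.1 this).resolve_left hl.ne'
    have h4 : f = 0 := Subtype.ext (hRpos _ h3)
    refine ContinuousLinearMap.ext fun h => ?_
    rw [hy, ← hf, h4]
    simp
  refine ⟨hdense, LinearPMap.eq_of_eq_graph ?_⟩
  rw [dualOp, Submodule.toLinearPMap_graph_eq]
  · ext ⟨f, g⟩
    rw [LinearPMap.mem_graph_iff]
    constructor
    · intro hfg
      replace hfg : ∀ x : J.domain, g (x : StrongDual ℝ Y) = f (J x) := hfg
      obtain ⟨y, hy⟩ := hrepr g
      -- If `J* f = y`, the solution `f'` of `(l R - J) f' = l R f + y` must be `f`: the difference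
      -- annihilates the range of `l R + J`, which is all of `Y`.
      obtain ⟨f', hf'⟩ := hsub (l • R f + y)
      have he : f - f' = 0 := by
        refine ContinuousLinearMap.ext fun z => ?_
        obtain ⟨h, rfl⟩ := hadd z
        have h1 := congrArg (h : StrongDual ℝ Y) hf'
        have h2 := hanti h f'
        have h3 := hfg h
        rw [hy] at h3
        simp only [map_add, map_sub, map_smul, smul_eq_mul] at h1
        rw [hRsymm (h : StrongDual ℝ Y) f, hRsymm (h : StrongDual ℝ Y) f', h2, h3] at h1
        simp only [sub_apply, map_add, map_smul, smul_eq_mul,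
          zero_apply]
        linarith
      have hff : (f' : StrongDual ℝ Y) = f := (sub_eq_zero.1 he).symm
      refine ⟨f', hff, ?_⟩
      have hJ : -J f' = y := by
        rw [hff] at hf'
        rw [sub_eq_add_neg] at hf'
        exact add_left_cancel hf'
      ext h
      change h (-J f') = g h
      rw [hJ, hy]
    · rintro ⟨f', hf', hg⟩ x
      simp only at hf' hg
      subst hf'
      subst hg
      change (x : StrongDual ℝ Y) (-J f') = (f' : StrongDual ℝ Y) (J x)
      rw [map_neg]
      exact (hanti f' x).symm
  · rintro ⟨f, g⟩ hfg h0
    simp only at h0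
    subst h0
    have h1 : ∀ x : J.domain, g (x : StrongDual ℝ Y) = 0 := fun x => by simpa using hfg x
    have : Set.EqOn g (0 : StrongDual ℝ (StrongDual ℝ Y)) (J.domain : Set (StrongDual ℝ Y)) :=
      fun x hx => h1 ⟨x, hx⟩
    exact ContinuousLinearMap.ext (congrFun
      (Continuous.ext_on hdense g.continuous (by fun_prop) this))

/-! ### Solvability by Lax-Milgram -/

/-- If a form `b` controls the norm up to a multiple of `Q₀`, and `Q₀ (·, 𝕁 ·)` is antisymmetric,
then `λ Q₀ + b 𝕁` is onto for large `λ`. -/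
theorem exists_solution {X : Type*} [NormedAddCommGroup X] [InnerProductSpace ℝ X]
    [CompleteSpace X] (Q₀ b : X →L[ℝ] StrongDual ℝ X) (𝕁 : X →L[ℝ] X) {C : ℝ}
    (h𝕁_inv : ∀ u, 𝕁 (𝕁 u) = -u) (h𝕁_Q₀ : ∀ u, Q₀ (𝕁 u) (𝕁 u) = Q₀ u u)
    (h𝕁_anti : ∀ u, Q₀ u (𝕁 u) = 0) (hQ₀_nonneg : ∀ u, 0 ≤ Q₀ u u)
    (hb : ∀ u, ‖u‖ ^ 2 / 2 - C * Q₀ u u ≤ b u u) :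
    ∃ l₀ : ℝ, ∀ l, l₀ ≤ l → ∀ g : StrongDual ℝ X, ∃ w, l • Q₀ w + b (𝕁 w) = g := by
  set m := ‖𝕁‖
  set μ := 2 * (‖b‖ * m + 1) with hμ
  have hm : 0 ≤ m := norm_nonneg _
  have hbm : 0 ≤ ‖b‖ * m := by positivity
  refine ⟨μ * C, fun l hl g => ?_⟩
  -- Testing with `v + μ 𝕁 v` produces the term `μ b (𝕁 w) (𝕁 w)`, which controls `μ ‖𝕁 w‖² / 2` up
  -- to `μ C Q₀ w w`. The latter is absorbed by `l Q₀ w w`; the choice of `μ` absorbs `b (𝕁 w) w`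
  -- and leaves `‖𝕁 w‖²`.
  let T : X →L[ℝ] X := ContinuousLinearMap.id ℝ X + μ • 𝕁
  let A : X →L[ℝ] StrongDual ℝ X := l • Q₀ + b.comp 𝕁
  let B : X →L[ℝ] X →L[ℝ] ℝ := A.bilinearComp (ContinuousLinearMap.id ℝ X) T
  have hB : ∀ w v, B w v = l * Q₀ w (v + μ • 𝕁 v) + b (𝕁 w) (v + μ • 𝕁 v) := fun w v => by
    simp [B, A, T]
  have hw : ∀ w, ‖w‖ ≤ m * ‖𝕁 w‖ := fun w => by
    have := 𝕁.le_opNorm (𝕁 w)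
    rwa [h𝕁_inv, norm_neg] at this
  have hcoer : IsCoercive B := by
    refine ⟨1 / (m ^ 2 + 1), by positivity, fun w => ?_⟩
    have h1 : -(‖b‖ * m * ‖𝕁 w‖ ^ 2) ≤ b (𝕁 w) w := by
      have h := (abs_le.1 (b.le_opNorm₂ (𝕁 w) w)).1
      have : ‖b‖ * ‖𝕁 w‖ * ‖w‖ ≤ ‖b‖ * ‖𝕁 w‖ * (m * ‖𝕁 w‖) := by gcongr; exact hw w
      nlinarith
    have h2 := hb (𝕁 w)
    rw [h𝕁_Q₀] at h2
    have h3 : ‖w‖ ^ 2 ≤ m ^ 2 * ‖𝕁 w‖ ^ 2 := by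
      rw [← mul_pow]
      exact pow_le_pow_left₀ (norm_nonneg _) (hw w) 2
    have h4 : ‖𝕁 w‖ ^ 2 ≤ B w w := by
      rw [hB]
      simp only [map_add, map_smul, smul_eq_mul, h𝕁_anti]
      have h5 := mul_le_mul_of_nonneg_left h2 (show 0 ≤ μ by positivity)
      have h6 := mul_le_mul_of_nonneg_right hl (hQ₀_nonneg w)
      have h7 : μ * (‖𝕁 w‖ ^ 2 / 2) = (‖b‖ * m + 1) * ‖𝕁 w‖ ^ 2 := by rw [hμ]; ring
      linarith
    rw [mul_assoc, ← sq, one_div, inv_mul_le_iff₀ (by positivity)]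
    nlinarith [sq_nonneg ‖𝕁 w‖, sq_nonneg m]
  let w := hcoer.continuousLinearEquivOfBilin.symm
    ((InnerProductSpace.toDual ℝ X).symm (g.comp T))
  have hwB : ∀ v, B w v = g (T v) := fun v => by
    rw [← hcoer.continuousLinearEquivOfBilin_apply, ContinuousLinearEquiv.apply_symm_apply,
      InnerProductSpace.toDual_symm_apply]
    rfl
  refine ⟨w, ContinuousLinearMap.ext fun v => ?_⟩
  -- As `𝕁² = -1`, `T` has inverse `(1 + μ²)⁻¹ (1 - μ 𝕁)`, so the tests `T v` exhaust `X`.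
  have hT : T ((1 + μ ^ 2)⁻¹ • (v - μ • 𝕁 v)) = v := by
    have : (1 + μ ^ 2) ≠ 0 := by positivity
    rw [map_smul, inv_smul_eq_iff₀ this]
    simp only [T, add_apply, ContinuousLinearMap.id_apply,
      smul_apply, map_sub, map_smul, h𝕁_inv]
    module
  have h := hwB ((1 + μ ^ 2)⁻¹ • (v - μ • 𝕁 v))
  rw [hT] at h
  rw [← h]
  change _ = A w (T _)
  rw [hT]
  rfl

/-! ### The operator `𝕁 Q₀⁻¹` and its restriction to `Y*` -/

theorem mem_symplecticOp_domain {X : Type*} [NormedAddCommGroup X] [NormedSpace ℝ X]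
    (𝕁 : X →L[ℝ] X) {Q₀ : X →L[ℝ] StrongDual ℝ X}
    {f : StrongDual ℝ X} : f ∈ (symplecticOp 𝕁 Q₀).domain ↔ ∃ w, Q₀ w = f := by
  change f ∈ (Q₀.toLinearMap.toPMap ⊤).inverse.domain ↔ _
  rw [LinearPMap.inverse_domain]
  constructor
  · rintro ⟨w, hw⟩
    exact ⟨w, hw⟩
  · rintro ⟨w, hw⟩
    exact ⟨⟨w, trivial⟩, hw⟩

theorem symplecticOp_apply {X : Type*} [NormedAddCommGroup X] [NormedSpace ℝ X]
    (𝕁 : X →L[ℝ] X) {Q₀ : X →L[ℝ] StrongDual ℝ X} (hinj : Function.Injective Q₀)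
    (f : (symplecticOp 𝕁 Q₀).domain) {w : X} (hw : Q₀ w = f) :
    symplecticOp 𝕁 Q₀ f = 𝕁 w := by
  have hk : LinearMap.ker (Q₀.toLinearMap.toPMap ⊤).toFun = ⊥ := by
    rw [LinearMap.ker_eq_bot]
    intro x y hxy
    exact Subtype.ext (hinj hxy)
  change 𝕁 ((Q₀.toLinearMap.toPMap ⊤).inverse f) = 𝕁 w
  rw [LinearPMap.inverse_apply_eq hk (x := ⟨w, trivial⟩) hw]

/-- The restriction of `𝕁 Q₀⁻¹` to the completion of `X` with respect to a form `b` that controls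
the norm of `X` up to a multiple of `Q₀` is anti-self-dual. -/
theorem isAntiSelfDual_restrictOp {X Y : Type*} [NormedAddCommGroup X] [InnerProductSpace ℝ X]
    [CompleteSpace X] [NormedAddCommGroup Y] [InnerProductSpace ℝ Y] [CompleteSpace Y]
    (Q₀ b : X →L[ℝ] StrongDual ℝ X) (𝕁 : X →L[ℝ] X) (i : X →L[ℝ] Y) {C : ℝ}
    (hQ₀_symm : IsSymm Q₀) (hQ₀_pos : ∀ u, u ≠ 0 → 0 < Q₀ u u)
    (h𝕁_inv : ∀ u, 𝕁 (𝕁 u) = -u) (h𝕁_Q₀ : ∀ u, Q₀ (𝕁 u) (𝕁 u) = Q₀ u u)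
    (hib : ∀ u v, inner ℝ (i u) (i v) = b u v)
    (hb : ∀ u, ‖u‖ ^ 2 / 2 - C * Q₀ u u ≤ b u u) :
    IsAntiSelfDual (restrictOp i (symplecticOp 𝕁 Q₀)) := by
  have hinj : Function.Injective Q₀ := (injective_iff_map_eq_zero _).2 fun u hu => by
    by_contra h
    simpa [hu] using hQ₀_pos u h
  have hnonneg : ∀ u, 0 ≤ Q₀ u u := fun u => by
    rcases eq_or_ne u 0 with rfl | h
    · simp
    · exact (hQ₀_pos u h).le
  have hanti : ∀ u v, Q₀ u (𝕁 v) = -Q₀ v (𝕁 u) := fun u v => by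
    have h1 : Q₀ (𝕁 u) (𝕁 (𝕁 v)) = Q₀ u (𝕁 v) := by
      -- Polarization of the invariance of `Q₀` under `𝕁`.
      have h := h𝕁_Q₀ (u + 𝕁 v)
      simp only [map_add, add_apply, h𝕁_Q₀, hQ₀_symm (𝕁 (𝕁 v)) (𝕁 u), hQ₀_symm (𝕁 v) u] at h
      linarith
    rw [← h1, h𝕁_inv, map_neg, hQ₀_symm]
  have hanti0 : ∀ u, Q₀ u (𝕁 u) = 0 := fun u => by linarith [hanti u u]
  obtain ⟨l₁, h₁⟩ := exists_solution Q₀ b 𝕁 h𝕁_inv h𝕁_Q₀ hanti0 hnonneg hb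
  -- `-𝕁` satisfies the same hypotheses and yields the other sign.
  obtain ⟨l₂, h₂⟩ := exists_solution Q₀ b (-𝕁) (by simpa using h𝕁_inv) (by simpa using h𝕁_Q₀)
    (by simpa using hanti0) hnonneg hb
  set l := max 1 (max l₁ l₂)
  have hl : 0 < l := zero_lt_one.trans_le (le_max_left _ _)
  have hmem : ∀ f : StrongDual ℝ Y, ∀ w, Q₀ w = f.comp i →
      ∃ hf : f ∈ (restrictOp i (symplecticOp 𝕁 Q₀)).domain,
        restrictOp i (symplecticOp 𝕁 Q₀) ⟨f, hf⟩ = i (𝕁 w) := fun f w hw =>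
    ⟨(mem_symplecticOp_domain 𝕁).2 ⟨w, hw⟩,
      congrArg i (symplecticOp_apply 𝕁 (f := ⟨f.comp i, _⟩) hinj hw)⟩
  have hsurj : ∀ (w : X) (z : X) (y : Y),
      l • Q₀ w + b z = (InnerProductSpace.toDual ℝ Y y).comp i →
      ∃ f : StrongDual ℝ Y, Q₀ w = f.comp i ∧
        l • (InnerProductSpace.toDual ℝ Y).symm f + i z = y := fun w z y h => by
    -- The second equation forces this `f`; the first then follows from the equation on `X`.
    refine ⟨InnerProductSpace.toDual ℝ Y (l⁻¹ • (y - i z)), ?_, ?_⟩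
    · ext v
      have hv := congrArg (fun g : StrongDual ℝ X => g v) h
      simp only [add_apply, smul_apply, smul_eq_mul, ContinuousLinearMap.comp_apply,
        InnerProductSpace.toDual_apply_apply] at hv
      rw [ContinuousLinearMap.comp_apply, InnerProductSpace.toDual_apply_apply,
        real_inner_smul_left, inner_sub_left, hib, ← hv]
      field_simp
      ring
    · rw [LinearIsometryEquiv.symm_apply_apply, smul_inv_smul₀ hl.ne']
      abel
  refine isAntiSelfDual_of_surjective _ ?_ hl ?_ ?_
  · rintro ⟨f, hf⟩ ⟨g, hg⟩
    obtain ⟨u, hu⟩ := (mem_symplecticOp_domain 𝕁).1 hf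
    obtain ⟨v, hv⟩ := (mem_symplecticOp_domain 𝕁).1 hg
    rw [(hmem f u hu).2, (hmem g v hv).2]
    change f.comp i (𝕁 v) = -g.comp i (𝕁 u)
    rw [← hu, ← hv, hanti]
  · intro y
    obtain ⟨w, hw⟩ := h₁ l ((le_max_left _ _).trans (le_max_right _ _))
      ((InnerProductSpace.toDual ℝ Y y).comp i)
    obtain ⟨f, hf, hy⟩ := hsurj w _ y hw
    obtain ⟨hfd, hJ⟩ := hmem f w hf
    exact ⟨⟨f, hfd⟩, by rw [hJ, hy]⟩
  · intro y
    obtain ⟨w, hw⟩ := h₂ l ((le_max_right _ _).trans (le_max_right _ _))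
      ((InnerProductSpace.toDual ℝ Y y).comp i)
    obtain ⟨f, hf, hy⟩ := hsurj w _ y hw
    obtain ⟨hfd, hJ⟩ := hmem f w hf
    refine ⟨⟨f, hfd⟩, ?_⟩
    rw [hJ, ← hy, neg_apply, map_neg, sub_eq_add_neg]

/-! ### Extension of `L` to the completion -/

/-- The bounded bilinear form `(P u, P v)`. -/
noncomputable def pullbackInner {E X : Type*} [NormedAddCommGroup E] [NormedSpace ℝ E]
    [NormedAddCommGroup X] [InnerProductSpace ℝ X] (P : E →L[ℝ] X) : E →L[ℝ] StrongDual ℝ E :=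
  let I : X →L[ℝ] X →L[ℝ] ℝ := innerSL ℝ
  I.bilinearComp P P

theorem pullbackInner_apply {E X : Type*} [NormedAddCommGroup E] [NormedSpace ℝ E]
    [NormedAddCommGroup X] [InnerProductSpace ℝ X] (P : E →L[ℝ] X) (u v : E) :
    pullbackInner P u v = inner ℝ (P u) (P v) :=
  rfl

/-- Let `X = M ⊕ X₊` with `M = X₋ ⊕ ker L`, and let `P` be the projection onto `M`. If `Y` is the
completion of `X` with respect to `L + c (P ·, P ·)`, and this form bounds `‖P ·‖²`, then `L`
extends to `Y`, and the extension has a uniform decomposition. -/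
theorem exists_extension {X Y : Type*} [NormedAddCommGroup X] [InnerProductSpace ℝ X]
    [CompleteSpace X] [NormedAddCommGroup Y] [InnerProductSpace ℝ Y]
    (L : X →L[ℝ] StrongDual ℝ X) (P : X →L[ℝ] X) (i : X →L[ℝ] Y) {c : ℝ}
    {Xm Xp : Submodule ℝ X} (hXm_fin : FiniteDimensional ℝ Xm)
    (hXm_neg : ∀ u ∈ Xm, u ≠ 0 → L u u < 0)
    (hP_mem : ∀ u, P u ∈ Xm ⊔ LinearMap.ker L.toLinearMap)
    (hP_fix : ∀ u ∈ Xm ⊔ LinearMap.ker L.toLinearMap, P u = u)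
    (hP_pos : ∀ u ∈ Xp, P u = 0)
    (hd : DenseRange i)
    (hib : ∀ u v, inner ℝ (i u) (i v) = L u v + c * inner ℝ (P u) (P v))
    (hPi : ∀ u, ‖P u‖ ≤ ‖i u‖) :
    ∃ L_Y : Y →L[ℝ] StrongDual ℝ Y, IsSymm L_Y ∧ (∀ u v, L_Y (i u) (i v) = L u v) ∧
      ∃ Ym Yp : Submodule ℝ Y, IsUniformDecomposition L_Y Ym Yp ∧ ∀ u ∈ Xp, i u ∈ Yp := by
  let p : Y →L[ℝ] X := P.toLinearMap.extendOfNorm i.toLinearMap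
  have hp : ∀ u, p (i u) = P u := fun u =>
    P.toLinearMap.extendOfNorm_eq (e := i.toLinearMap) hd ⟨1, by simpa using hPi⟩ u
  have hPp : ∀ y, P (p y) = p y := fun y =>
    congrFun (hd.equalizer (P.comp p).continuous p.continuous
      (funext fun u => by simp [hp, hP_fix _ (hP_mem u)])) y
  have hp_mem : ∀ y, p y ∈ Xm ⊔ LinearMap.ker L.toLinearMap := fun y => hPp y ▸ hP_mem _
  let L_Y : Y →L[ℝ] StrongDual ℝ Y :=
    pullbackInner (ContinuousLinearMap.id ℝ Y) - c • pullbackInner p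
  have hL : ∀ y z, L_Y y z = inner ℝ y z - c * inner ℝ (p y) (p z) := fun y z => by
    simp [L_Y, pullbackInner_apply]
  have hsymm : IsSymm L_Y := fun y z => by
    rw [hL, hL, real_inner_comm, real_inner_comm (p y)]
  have hext : ∀ u v, L_Y (i u) (i v) = L u v := fun u v => by
    rw [hL, hib, hp, hp]; ring
  have hker : ∀ u, L u = 0 → L_Y (i u) = 0 := fun u hu =>
    ContinuousLinearMap.ext (congrFun (hd.equalizer (L_Y (i u)).continuous
      (0 : StrongDual ℝ Y).continuous (funext fun v => by simp [hext, hu])))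
  refine ⟨L_Y, hsymm, hext, Xm.map i.toLinearMap, LinearMap.ker p.toLinearMap,
    ⟨?_, p.isClosed_ker, ⟨?_, ?_, ?_⟩, inferInstance, ?_, 1, one_pos, ?_⟩, ?_⟩
  · exact Submodule.closed_of_finiteDimensional _
  · rw [Submodule.disjoint_def]
    rintro _ ⟨u, hu, rfl⟩ hk
    by_contra h
    have h1 : L u u = 0 := by
      rw [← hext]
      exact congrArg (fun g : StrongDual ℝ Y => g (i u)) hk
    refine (hXm_neg u hu ?_).ne h1
    rintro rfl
    exact h (map_zero _)
  · rw [Submodule.disjoint_def]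
    intro y hy hpy
    obtain ⟨_, ⟨u, hu, rfl⟩, n, hn, rfl⟩ := Submodule.mem_sup.1 hy
    replace hpy : p (i u + n) = 0 := hpy
    replace hn : L_Y n = 0 := hn
    change i u + n = 0
    -- On `ker p` the form `L_Y` is the squared norm, while on `Ym ⊕ ker L_Y` it is at most zero, so
    -- the intersection is trivial.
    have h1 : L_Y (i u + n) (i u + n) = L u u := by
      rw [map_add, hsymm _ n, hn, map_add, hn, add_zero, hext, zero_apply, add_zero]
    rw [hL, hpy, inner_zero_left, mul_zero, sub_zero] at h1
    have h2 : L u u ≤ 0 := by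
      rcases eq_or_ne u 0 with rfl | h
      · simp
      · exact (hXm_neg u hu h).le
    rw [← h1, real_inner_self_eq_norm_sq] at h2
    exact norm_eq_zero.1 (pow_eq_zero_iff two_ne_zero |>.1 (h2.antisymm (sq_nonneg _)))
  · rw [codisjoint_iff, Submodule.eq_top_iff']
    intro y
    refine Submodule.mem_sup.2 ⟨i (p y), ?_, y - i (p y), ?_, add_sub_cancel _ _⟩
    · obtain ⟨u, hu, n, hn, h⟩ := Submodule.mem_sup.1 (hp_mem y)
      rw [← h, map_add]
      exact Submodule.add_mem_sup (Submodule.mem_map_of_mem hu) (hker n hn)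
    · change p (y - i (p y)) = 0
      rw [map_sub, hp, hPp, sub_self]
  · rintro _ ⟨u, hu, rfl⟩ h
    refine (hext u u).trans_lt (hXm_neg u hu ?_)
    rintro rfl
    exact h (map_zero _)
  · intro y hy
    replace hy : p y = 0 := hy
    rw [hL, hy, inner_zero_left, mul_zero, sub_zero, real_inner_self_eq_norm_sq, one_mul]
  · intro u hu
    change p (i u) = 0
    rw [hp, hP_pos u hu]

end LinHam

/-! ### Assembly of the Hamiltonian system on `Y` -/

theorem theorem2p8 {X : Type u} [NormedAddCommGroup X] [InnerProductSpace ℝ X] [CompleteSpace X]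
    (Q₀ Q₁ L : X →L[ℝ] StrongDual ℝ X) (𝕁 : X →L[ℝ] X) (Xm Xp : Submodule ℝ X) (c₀ : ℝ)
    -- `Q₀`, `Q₁` are symmetric, positive, and `Q₀ + Q₁` represents the inner product
    (hQ₀_symm : LinHam.IsSymm Q₀) (hQ₁_symm : LinHam.IsSymm Q₁)
    (hQ₀_pos : ∀ u : X, u ≠ 0 → 0 < Q₀ u u) (hQ₁_pos : ∀ u : X, u ≠ 0 → 0 < Q₁ u u)
    (hQ_add : ∀ u v : X, (Q₀ + Q₁) u v = inner ℝ u v)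
    -- `𝕁⁻¹ = -𝕁` and `𝕁` preserves the quadratic form of `Q₀`
    (h𝕁_inv : ∀ u : X, 𝕁 (𝕁 u) = -u) (h𝕁_Q₀ : ∀ u : X, Q₀ (𝕁 u) (𝕁 u) = Q₀ u u)
    -- `L` is symmetric and `L₁ = L - Q₁` is a perturbation of lower order
    (hL_symm : LinHam.IsSymm L)
    (hL₁ : ∀ u v : X, |(L - Q₁) u v| ^ 2 ≤
      c₀ * (Q₀ u u * Q₀ v v + Q₀ u u * Q₁ v v + Q₁ u u * Q₀ v v))
    -- the decomposition `X = X₋ ⊕ ker L ⊕ X₊`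
    (hXm_closed : IsClosed (Xm : Set X)) (hXp_closed : IsClosed (Xp : Set X))
    (hX : LinHam.IsDirectSum Xm (LinearMap.ker L.toLinearMap) Xp)
    (hXm_fin : FiniteDimensional ℝ Xm)
    (hXp_pos : ∀ u ∈ Xp, u ≠ 0 → 0 < L u u) (hXm_neg : ∀ u ∈ Xm, u ≠ 0 → L u u < 0)
    (hL_orth : ∀ u ∈ Xp, ∀ v ∈ Xm, L u v = 0)
    -- every functional vanishing on `X₊` lies in `D(J) = Q₀(X)`
    (hXp_ann : ∀ f : StrongDual ℝ X, (∀ u ∈ Xp, f u = 0) → ∃ w : X, Q₀ w = f) :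
    ∃ (Y : Type u) (_ : NormedAddCommGroup Y) (_ : InnerProductSpace ℝ Y) (_ : CompleteSpace Y)
      (i : X →L[ℝ] Y) (L_Y : Y →L[ℝ] StrongDual ℝ Y),
      -- `X` is densely embedded into `Y`
      Function.Injective i ∧ DenseRange i ∧
      -- `L_Y` is a bounded symmetric extension of `L`
      LinHam.IsSymm L_Y ∧ (∀ u v : X, L_Y (i u) (i v) = L u v) ∧
      -- `(Y, L_Y, J_Y)` is a linear Hamiltonian system, `J_Y` being the restriction of `J`
      LinHam.IsHamiltonianSystem L_Y (LinHam.restrictOp i (LinHam.symplecticOp 𝕁 Q₀)) := by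
  have hM_closed : IsClosed ((Xm ⊔ LinearMap.ker L.toLinearMap : Submodule ℝ X) : Set X) := by
    rw [sup_comm]
    exact Submodule.isClosed_sup_finiteDimensional _ _ L.isClosed_ker
  have htop := Submodule.IsCompl.isTopCompl_of_isClosed hX.2 hM_closed hXp_closed
  set M := Xm ⊔ LinearMap.ker L.toLinearMap with hM
  let P : X →L[ℝ] X := M.projectionL Xp htop
  have hP_mem : ∀ u, P u ∈ M := fun u => Submodule.projection_apply_mem htop.isCompl u
  have hP_fix : ∀ u ∈ M, P u = u := fun u hu => Submodule.projection_apply_of_mem_left _ hu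
  have hP_pos : ∀ u ∈ Xp, P u = 0 := fun u hu => Submodule.projection_apply_of_mem_right _ hu
  have hP_sub : ∀ u, u - P u ∈ Xp := fun u =>
    (Submodule.projection_apply_eq_zero_iff htop.isCompl).1 <| by
      change P (u - P u) = 0
      rw [map_sub, hP_fix _ (hP_mem u), sub_self]
  have hLM : ∀ u ∈ Xp, ∀ v ∈ M, L u v = 0 := fun u hu v hv => by
    obtain ⟨a, ha, n, hn, rfl⟩ := Submodule.mem_sup.1 hv
    replace hn : L n = 0 := hn
    rw [map_add, hL_orth u hu a ha, hL_symm u n, hn, zero_apply, add_zero]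
  have hL_split : ∀ u, L u u = L (u - P u) (u - P u) + L (P u) (P u) := fun u => by
    have h := hLM _ (hP_sub u) _ (hP_mem u)
    have h' := hL_symm u (P u)
    simp only [map_sub, sub_apply] at h ⊢
    linarith
  have hXp_nonneg : ∀ u ∈ Xp, 0 ≤ L u u := fun u hu => by
    rcases eq_or_ne u 0 with rfl | h
    · simp
    · exact (hXp_pos u hu h).le
  have hL_lower : ∀ u, -(‖L‖ * ‖u‖ ^ 2) ≤ L u u := fun u => by
    have h := (abs_le.1 (L.le_opNorm₂ u u)).1
    linarith
  -- `‖L‖` offsets the negative part of `L` on `M`; the extra `1` leaves `‖P u‖²`, so that `P` is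
  -- bounded in the norm of `Y`.
  let b : X →L[ℝ] StrongDual ℝ X := L + (‖L‖ + 1) • LinHam.pullbackInner P
  have hb : ∀ u v, b u v = L u v + (‖L‖ + 1) * inner ℝ (P u) (P v) := fun u v => by
    simp [b, LinHam.pullbackInner_apply]
  have hb_lower : ∀ u, L (u - P u) (u - P u) + ‖P u‖ ^ 2 ≤ b u u := fun u => by
    rw [hb, hL_split u, real_inner_self_eq_norm_sq]
    linarith [hL_lower (P u)]
  have hb_symm : LinHam.IsSymm b := fun u v => by
    rw [hb, hb, hL_symm, real_inner_comm]
  have hb_pos : ∀ u, u ≠ 0 → 0 < b u u := fun u hu => by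
    refine lt_of_lt_of_le ?_ (hb_lower u)
    rcases eq_or_ne (P u) 0 with h | h
    · have h1 := hXp_pos (u - P u) (hP_sub u) (by simpa [h] using hu)
      positivity
    · have h1 := hXp_nonneg _ (hP_sub u)
      have : 0 < ‖P u‖ := norm_pos_iff.2 h
      positivity
  have hb_coer : ∀ u, ‖u‖ ^ 2 / 2 - (1 + |c₀|) * Q₀ u u ≤ b u u := fun u => by
    rcases eq_or_ne u 0 with rfl | hu
    · simp
    have h0 := hQ₀_pos u hu
    have h1 := hQ₁_pos u hu
    have hn : Q₀ u u + Q₁ u u = ‖u‖ ^ 2 := by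
      rw [← real_inner_self_eq_norm_sq, ← hQ_add, add_apply, add_apply]
    have hL1 : |(L - Q₁) u u| ≤ ‖u‖ ^ 2 / 2 + |c₀| * Q₀ u u := by
      refine abs_le_of_sq_le_sq' ?_ (by positivity) |>.2
      rw [sq_abs]
      have h2 := hL₁ u u
      rw [sq_abs] at h2
      refine h2.trans ?_
      have h3 : c₀ * (Q₀ u u * Q₀ u u + Q₀ u u * Q₁ u u + Q₁ u u * Q₀ u u) ≤
          |c₀| * (Q₀ u u * Q₀ u u + Q₀ u u * Q₁ u u + Q₁ u u * Q₀ u u) :=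
        mul_le_mul_of_nonneg_right (le_abs_self _) (by positivity)
      have h4 : |c₀| * (Q₀ u u * Q₀ u u) ≥ 0 := by positivity
      rw [← hn]
      -- With `a = ‖u‖²`, `q = Q₀ u u`, `c = |c₀|`, the difference of the two sides is `(a / 2 - c
      -- q)² + c q²`.
      nlinarith [sq_nonneg ((Q₀ u u + Q₁ u u) / 2 - |c₀| * Q₀ u u)]
    have h5 := neg_le_of_abs_le hL1
    have h6 : (L - Q₁) u u = L u u - Q₁ u u := rfl
    have h7 : L u u ≤ b u u := by
      rw [hb, real_inner_self_eq_norm_sq]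
      have : 0 ≤ (‖L‖ + 1) * ‖P u‖ ^ 2 := by positivity
      linarith
    linarith
  obtain ⟨Y, _, _, _, i, hi, hd, hib⟩ := LinHam.exists_completion_of_form b hb_symm hb_pos
  have hPi : ∀ u, ‖P u‖ ≤ ‖i u‖ := fun u => by
    refine abs_le_of_sq_le_sq' ?_ (norm_nonneg _) |>.2
    rw [← real_inner_self_eq_norm_sq (i u), hib]
    linarith [hb_lower u, hXp_nonneg _ (hP_sub u)]
  obtain ⟨L_Y, hsymm, hext, Ym, Yp, hdec, hYp⟩ := LinHam.exists_extension L P i hXm_fin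
    hXm_neg hP_mem hP_fix hP_pos hd (fun u v => (hib u v).trans (hb u v)) hPi
  refine ⟨Y, inferInstance, inferInstance, inferInstance, i, L_Y, hi, hd, hsymm, hext,
    LinHam.isAntiSelfDual_restrictOp Q₀ b 𝕁 i hQ₀_symm hQ₀_pos h𝕁_inv h𝕁_Q₀ hib hb_coer,
    hsymm, Ym, Yp, hdec, fun f hf => ?_⟩
  -- `Yp` contains `i(X₊)`, so `i* f` vanishes on `X₊` and (B5) applies.
  exact (LinHam.mem_symplecticOp_domain 𝕁).2
    (hXp_ann _ fun u hu => hf _ (Submodule.mem_sup_right (hYp u hu)))
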